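/- Let $\Sigma$ be a finite alphabet, $a\in\Sigma$, let $\mathfrak D$ be an infinite set of data values, and let $e_1,e_2,\dots\in\mathfrak D$ be pairwise distinct (for instance $\Sigma=\{a\}$, $\mathfrak D=\mathbb N$, $e_i=i$). A data word (with two data values) is a finite word $w=(a_1,d_1)\dots(a_n,d_n)$ over $\Sigma\times\mathfrak D^2$, $d_i=(d_i^1,d_i^2)$. On its positions $[n]=\{1,\dots,n\}$ consider the relations of the signature $\mathscr S=\mathscr S^2_{+1,\sim}=\{\prec_{+1},\prec_\sim^1,\prec_\sim^2\}$: $i\prec_{+1}j$ iff $j=i+1$; and $i\prec_\sim^k j$ iff $i<j$, $d_i^k=d_j^k$ and $d_{i'}^k\ne d_i^k$ for all $i<i'<j$. For $\lhd\in\mathscr S$, $\mathrm{prev}_\lhd(i)$ is the (unique, if existing) $j$ with $j\lhd i$, and $\mathrm{next}_\lhd(i)$ the (unique, if existing) $j$ with $i\lhd j$. The graph $G(w)$ has nodes $[n]$, edge relations $\lhd\in\mathscr S$, and each node $i$ is labeled with the letter $a_i$ and with the partition of $\{1,2\}$ in which $k,l$ are in the same part iff $d_i^k=d_i^l$. For a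 set $K$ of data words, $[K]_{\mathscr S}$ is the set of data words $w$ with $G(w)\cong G(w')$ for some $w'\in K$. Let $$L=\bigl[\{(a,e_1,e_1)\dots(a,e_n,e_n)(a,e_1,e_1)\dots(a,e_n,e_n)\mid n\ge1\}\bigr]_{\mathscr S}.$$ **Theorem.** $L\in\mathrm{rEMSO}(\mathscr S)\cap\mathrm{CRA}^-(\mathscr S)$, but $L$ is not recognized by any class automaton. Here: * $\mathrm{rEMSO}(\mathscr S)$ is the class of languages of data words defined by sentences $\exists X_1\dots\exists X_r\,\varphi$, where $X_1,\dots,X_r$ ($r\ge 0$) range over sets of positions and $\varphi$ is built from the atoms $\ell(x)=b$ ($b\in\Sigma$; the label of $x$ is $b$), $d^k(x)=d^l(x)$ ($k,l\in\{1,2\}$; the $k$-th and the $l$-th data value of the same position $x$ coincide), $x\lhd y$ ($\lhd\in\mathscr S$), $x=y$, $x\in X$ by $\neg$, $\vee$ and quantification $\exists x$ over positions. * $\mathrm{CRA}^-(\mathscr S)$ is the class of languages of non-guessing class register automata. Such an automaton consists of finite sets $Q$ of states and $R$ of registers, sets $F_\lhd\subseteq Q$ ($\lhd\in\mathscr S$)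 of local final states, a boolean formula $\Phi$ over atoms "$q\le N$" ($q\in Q$, $N\in\mathbb N$), and a finite set of transitions $(p,g)\xrightarrow{b}(q,f)$ with a partial map $p:\mathscr S\rightharpoonup Q$, a boolean formula $g$ over atoms "$\theta_1=\theta_2$" with $\theta_1,\theta_2\in\{1,2\}\cup(\mathrm{dom}(p)\times R)$, $b\in\Sigma$, $q\in Q$, and a partial map $f:R\rightharpoonup(\mathrm{dom}(p)\times R)\cup\{1,2\}$. A run on $w$ is a sequence $(q_1,\rho_1)\dots(q_n,\rho_n)$ of states $q_i\in Q$ and partial maps $\rho_i:R\rightharpoonup\mathfrak D$ such that for every $i\in[n]$ some transition $(p,g)\xrightarrow{a_i}(q_i,f)$ satisfies: $\mathrm{dom}(p)=\{\lhd\mid\mathrm{prev}_\lhd(i)\text{ is defined}\}$ and $p(\lhd)=q_{\mathrm{prev}_\lhd(i)}$ on it; $g$ is true, where $\theta_1=\theta_2$ holds iff the values of $\theta_1$ and $\theta_2$ are both defined and equal, $k\in\{1,2\}$ having the value $d_i^k$ and $(\lhd,r)$ the value $\rho_{\mathrm{prev}_\lhd(i)}(r)$; and for each $r\in R$, $\rho_i(r)$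 is the value (possibly undefined) of $f(r)$ in the same sense if $f(r)$ is defined, and undefined otherwise. The word $w$ is accepted if there is a run such that $q_i\in F_\lhd$ whenever $\mathrm{next}_\lhd(i)$ is undefined and $\Phi$ is true, where $q\le N$ holds iff $|\{i\mid q_i=q\}|\le N$. * A class automaton (in the sense of Bojańczyk and Lasota) is a pair $(\mathcal A,\mathcal B)$, where $\mathcal A$ is a non-deterministic finite-state letter-to-letter transducer from $\Sigma$ to a finite alphabet $\Gamma$ and $\mathcal B$ is a finite automaton over $\Gamma\times\{0,1\}^2$. It recognizes the set of data words $w$ for which $\mathcal A$ has some output $u_1\dots u_n\in\Gamma^*$ on input $a_1\dots a_n$ such that, for all $d\in\mathfrak D$, $\mathcal B$ accepts $(u_1,b_1)\dots(u_n,b_n)$, where $b_i^k=1$ iff $d_i^k=d$. -/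

import Mathlib

namespace DataWords

universe u v

/-! ### Data words and signatures -/

/-- Data words over the label alphabet `A`, with `m` data values from `D` at each position. -/
abbrev Word (A : Type u) (D : Type v) (m : ℕ) : Type (max u v) := List (A × (Fin m → D))

/-- The positions of a word (numbered from `0`). -/
abbrev Pos {A : Type u} {D : Type v} {m : ℕ} (w : Word A D m) : Type := Fin w.length

/-- The label of position `i`. -/
def label {A : Type u} {D : Type v} {m : ℕ} (w : Word A D m) (i : Pos w) : A := (w.get i).1

/-- The `k`-th data value of position `i`. -/
def dval {A : Type u} {D : Type v} {m : ℕ} (w : Word A D m) (i : Pos w) (k : Fin m) : D :=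
  (w.get i).2 k

/-- A signature: a finite set of binary relation symbols, with an interpretation over each data
word that complies with `<`, has out-degree and in-degree at most one, and is monotone. -/
structure Signature (A : Type u) (D : Type v) (m : ℕ) where
  Sym : Type
  finite_sym : Finite Sym
  rel : (w : Word A D m) → Sym → Pos w → Pos w → Prop
  lt_of_rel : ∀ w s i j, rel w s i j → i < j
  out_unique : ∀ w s i j j', rel w s i j → rel w s i j' → j = j'
  in_unique : ∀ w s i i' j, rel w s i j → rel w s i' j → i = i'
  monotone : ∀ w s i j i' j', rel w s i j → rel w s i' j' →
    w.get i = w.get i' → w.get j = w.get j' → (i < i' ↔ j < j')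

section Relations

variable {A : Type u} {D : Type v} {m : ℕ} (S : Signature A D m) (w : Word A D m)

open Classical in
/-- The partial function `prev_s`: the position `j` with `j s i`, if there is one. -/
noncomputable def prev (s : S.Sym) (i : Pos w) : Option (Pos w) :=
  if h : ∃ j, S.rel w s j i then some h.choose else none

theorem prev_eq_some_iff (s : S.Sym) (i j : Pos w) :
    prev S w s i = some j ↔ S.rel w s j i := by
  unfold prev
  split_ifs with h
  · constructor
    · intro e
      have e' := Option.some.inj e
      rw [← e']
      exact h.choose_spec
    · intro e
      rw [S.in_unique w s _ _ i h.choose_spec e]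
  · constructor
    · intro e
      cases e
    · intro e
      exact absurd ⟨j, e⟩ h

end Relations

/-! ### The graph of a data word, equivalence, spheres -/

/-- Node- and edge-labeled graphs over a signature. A partition of the set of data indices is
given by the corresponding equivalence relation. -/
structure SGraph {A : Type u} {D : Type v} {m : ℕ} (S : Signature A D m) where
  V : Type
  finite_V : Finite V
  edge : S.Sym → V → V → Prop
  out_unique : ∀ s i j j', edge s i j → edge s i j' → j = j'
  in_unique : ∀ s i i' j, edge s i j → edge s i' j → i = i'
  nodeLabel : V → A
  nodePart : V → Setoid (Fin m)

section Graphs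

variable {A : Type u} {D : Type v} {m : ℕ} {S : Signature A D m}

/-- `G` and `H` are isomorphic. -/
def SGraph.Isomorphic (G H : SGraph S) : Prop :=
  ∃ h : G.V ≃ H.V,
    (∀ s i j, G.edge s i j ↔ H.edge s (h i) (h j)) ∧
    (∀ i, G.nodeLabel i = H.nodeLabel (h i)) ∧
    (∀ i, G.nodePart i = H.nodePart (h i))

/-- The underlying undirected graph. -/
def SGraph.undirected (G : SGraph S) : SimpleGraph G.V :=
  SimpleGraph.fromRel (fun i j => ∃ s, G.edge s i j)

variable (S)

/-- The graph of a data word: `k` and `l` are in the same part at position `i` iff the `k`-th and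
the `l`-th data value of `i` coincide. -/
def graph (w : Word A D m) : SGraph S where
  V := Pos w
  finite_V := inferInstance
  edge := S.rel w
  out_unique := S.out_unique w
  in_unique := S.in_unique w
  nodeLabel := label w
  nodePart := fun i => Setoid.ker (dval w i)

/-- Two data words are equivalent if their graphs are isomorphic. -/
def Equivalent (w w' : Word A D m) : Prop := (graph S w).Isomorphic (graph S w')

/-- `[L]_S`: the words that are equivalent to some word of `L`. -/
def equivClosure (L : Set (Word A D m)) : Set (Word A D m) :=
  {w | ∃ w' ∈ L, Equivalent S w w'}

/-- The set of `k`-th data values of positions at distance at most `B` from `i` (the distance is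
infinite if there is no path). -/
def sphereValues (w : Word A D m) (B : ℕ) (k : Fin m) (i : Pos w) : Set D :=
  {d | ∃ j : Pos w, (graph S w).undirected.edist i j ≤ (B : ℕ∞) ∧ d = dval w j k}

end Graphs

/-! ### Monadic second-order logic -/

/-- Formulas of monadic second-order logic over `S`; first-order and second-order variables are
named by natural numbers. -/
inductive MSO {A : Type u} {D : Type v} {m : ℕ} (S : Signature A D m) : Type u
  | lab (x : ℕ) (a : A) : MSO S
  | dataEq (k : Fin m) (x : ℕ) (l : Fin m) (y : ℕ) : MSO S
  | rel (s : S.Sym) (x y : ℕ) : MSO S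
  | eq (x y : ℕ) : MSO S
  | mem (x X : ℕ) : MSO S
  | neg (φ : MSO S) : MSO S
  | or (φ ψ : MSO S) : MSO S
  | exFO (x : ℕ) (φ : MSO S) : MSO S
  | exSO (X : ℕ) (φ : MSO S) : MSO S

namespace MSO

variable {A : Type u} {D : Type v} {m : ℕ} {S : Signature A D m}

/-- Satisfaction under a partial assignment `α` of positions to first-order variables (partial,
since the empty word has no positions) and an assignment `β` of sets to second-order variables. -/
def Sat (w : Word A D m) : MSO S → (ℕ → Option (Pos w)) → (ℕ → Set (Pos w)) → Prop
  | lab x a, α, _ => ∃ i, α x = some i ∧ label w i = a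
  | dataEq k x l y, α, _ => ∃ i j, α x = some i ∧ α y = some j ∧ dval w i k = dval w j l
  | rel s x y, α, _ => ∃ i j, α x = some i ∧ α y = some j ∧ S.rel w s i j
  | eq x y, α, _ => ∃ i j, α x = some i ∧ α y = some j ∧ i = j
  | mem x X, α, β => ∃ i, α x = some i ∧ i ∈ β X
  | neg φ, α, β => ¬ Sat w φ α β
  | or φ ψ, α, β => Sat w φ α β ∨ Sat w ψ α β
  | exFO x φ, α, β => ∃ i : Pos w, Sat w φ (Function.update α x (some i)) β
  | exSO X φ, α, β => ∃ I : Set (Pos w), Sat w φ α (Function.update β X I)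

/-- The free first-order variables. -/
def freeFO : MSO S → Set ℕ
  | lab x _ => {x}
  | dataEq _ x _ y => {x, y}
  | rel _ x y => {x, y}
  | eq x y => {x, y}
  | mem x _ => {x}
  | neg φ => freeFO φ
  | or φ ψ => freeFO φ ∪ freeFO ψ
  | exFO x φ => freeFO φ \ {x}
  | exSO _ φ => freeFO φ

/-- The free second-order variables. -/
def freeSO : MSO S → Set ℕ
  | lab _ _ => ∅
  | dataEq _ _ _ _ => ∅
  | rel _ _ _ => ∅
  | eq _ _ => ∅
  | mem _ X => {X}
  | neg φ => freeSO φ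
  | or φ ψ => freeSO φ ∪ freeSO ψ
  | exFO _ φ => freeSO φ
  | exSO X φ => freeSO φ \ {X}

/-- Sentences: no free variables. -/
def IsSentence (φ : MSO S) : Prop := φ.freeFO = ∅ ∧ φ.freeSO = ∅

/-- First-order formulas: no second-order quantifier. -/
def IsFO : MSO S → Prop
  | lab _ _ => True
  | dataEq _ _ _ _ => True
  | rel _ _ _ => True
  | eq _ _ => True
  | mem _ _ => True
  | neg φ => IsFO φ
  | or φ ψ => IsFO φ ∧ IsFO ψ
  | exFO _ φ => IsFO φ
  | exSO _ _ => False

/-- Existential formulas `∃ X₁ … ∃ Xₙ, φ` with `φ` first-order. -/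
inductive IsEMSO : MSO S → Prop
  | ofFO (φ : MSO S) (h : φ.IsFO) : IsEMSO φ
  | exSO (X : ℕ) (φ : MSO S) (h : IsEMSO φ) : IsEMSO (MSO.exSO X φ)

/-- The local (restricted) logic: data values may be compared only within a single position. -/
def IsLocal : MSO S → Prop
  | lab _ _ => True
  | dataEq _ x _ y => x = y
  | rel _ _ _ => True
  | eq _ _ => True
  | mem _ _ => True
  | neg φ => IsLocal φ
  | or φ ψ => IsLocal φ ∧ IsLocal ψ
  | exFO _ φ => IsLocal φ
  | exSO _ φ => IsLocal φ

/-- The set of models of a sentence. -/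
def lang (φ : MSO S) : Set (Word A D m) :=
  {w | φ.Sat w (fun _ => none) (fun _ => ∅)}

end MSO

/-- The class of languages defined by sentences of restricted existential monadic second-order
logic over `S`. -/
def rEMSO {A : Type u} {D : Type v} {m : ℕ} (S : Signature A D m) : Set (Set (Word A D m)) :=
  {L | ∃ φ : MSO S, φ.IsSentence ∧ φ.IsEMSO ∧ φ.IsLocal ∧ φ.lang = L}

/-! ### Class register automata -/

/-- Boolean formulas over a set `X` of atoms. -/
inductive BoolFormula (X : Type*)
  | tt : BoolFormula X
  | ff : BoolFormula X
  | atom (x : X) : BoolFormula X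
  | neg (b : BoolFormula X) : BoolFormula X
  | or (b c : BoolFormula X) : BoolFormula X
  | and (b c : BoolFormula X) : BoolFormula X

/-- The truth value of a boolean formula under the truth assignment `t`. -/
def BoolFormula.Eval {X : Type*} (t : X → Prop) : BoolFormula X → Prop
  | tt => True
  | ff => False
  | atom x => t x
  | neg b => ¬ b.Eval t
  | or b c => b.Eval t ∨ c.Eval t
  | and b c => b.Eval t ∧ c.Eval t

/-- A transition `(p, g) —a→ (q, f)`. A guard atom `(θ₁, θ₂)` stands for `θ₁ = θ₂`. -/
structure Transition {A : Type u} {D : Type v} {m : ℕ} (S : Signature A D m) (Q R : Type) where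
  /-- the source states `p`, a partial map with domain `{s // (p s).isSome}` -/
  source : S.Sym → Option Q
  guard : BoolFormula ((Fin m ⊕ {s : S.Sym // (source s).isSome} × R) ×
    (Fin m ⊕ {s : S.Sym // (source s).isSome} × R))
  letter : A
  target : Q
  /-- the partial register update `f` -/
  update : R → Option (({s : S.Sym // (source s).isSome} × R) ⊕ (Fin m × ℕ))

/-- Class register automata over `S`. -/
structure ClassRegisterAutomaton {A : Type u} {D : Type v} {m : ℕ} (S : Signature A D m) where
  Q : Type
  finite_Q : Finite Q
  R : Type
  finite_R : Finite R
  Δ : Set (Transition S Q R)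
  finite_Δ : Δ.Finite
  /-- local final states -/
  F : S.Sym → Set Q
  /-- the global acceptance condition; an atom `(q, N)` stands for `q ≤ N` -/
  Φ : BoolFormula (Q × ℕ)

section Runs

variable {A : Type u} {D : Type v} {m : ℕ} {S : Signature A D m} {Q R : Type}

/-- The value `val_i(θ)` at position `i`, if the registers contain `ρ`; it may be undefined. -/
noncomputable def termVal (w : Word A D m) (ρ : Pos w → R → Option D) (i : Pos w)
    {P : S.Sym → Prop} : Fin m ⊕ {s : S.Sym // P s} × R → Option D
  | Sum.inl k => some (dval w i k)
  | Sum.inr (s, r) => (prev S w s.1 i).bind (fun j => ρ j r)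

/-- The register entry `x` is a possible result at position `i` of the update `f(r) = o`. -/
def UpdateOK (w : Word A D m) (ρ : Pos w → R → Option D) (i : Pos w) {P : S.Sym → Prop}
    (o : Option (({s : S.Sym // P s} × R) ⊕ (Fin m × ℕ))) (x : Option D) : Prop :=
  match o with
  | none => x = none
  | some (Sum.inl (s, r')) => x = (prev S w s.1 i).bind (fun j => ρ j r')
  | some (Sum.inr (k, B)) => ∃ d ∈ sphereValues S w B k i, x = some d

/-- Transition `t` justifies the configuration at position `i` in the sequence of configurations
`(q i, ρ i)`. The equation for `source` says both that its domain is the set of those `s` for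
which `prev_s(i)` is defined, and that `p_s` is the state at `prev_s(i)`. -/
def Transition.Fires (t : Transition S Q R) (w : Word A D m) (q : Pos w → Q)
    (ρ : Pos w → R → Option D) (i : Pos w) : Prop :=
  t.letter = label w i ∧
  t.target = q i ∧
  (∀ s, t.source s = (prev S w s i).map q) ∧
  t.guard.Eval (fun θ => ∃ d : D, termVal w ρ i θ.1 = some d ∧ termVal w ρ i θ.2 = some d) ∧
  (∀ r, UpdateOK w ρ i (t.update r) (ρ i r))

end Runs

namespace ClassRegisterAutomaton

variable {A : Type u} {D : Type v} {m : ℕ} {S : Signature A D m}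

/-- The sequence of configurations `(q i, ρ i)` is a run on `w`. -/
def IsRun (M : ClassRegisterAutomaton S) (w : Word A D m) (q : Pos w → M.Q)
    (ρ : Pos w → M.R → Option D) : Prop :=
  ∀ i, ∃ t ∈ M.Δ, t.Fires w q ρ i

/-- Acceptance: the local final states at the positions without `s`-successor, and the global
condition. -/
def Accepting (M : ClassRegisterAutomaton S) (w : Word A D m) (q : Pos w → M.Q) : Prop :=
  (∀ i s, (¬ ∃ j, S.rel w s i j) → q i ∈ M.F s) ∧
  M.Φ.Eval (fun c => {i | q i = c.1}.ncard ≤ c.2)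

/-- The recognized language. -/
def lang (M : ClassRegisterAutomaton S) : Set (Word A D m) :=
  {w | ∃ q ρ, M.IsRun w q ρ ∧ M.Accepting w q}

/-- Non-guessing automata: an update from the input only takes current data values. -/
def NonGuessing (M : ClassRegisterAutomaton S) : Prop :=
  ∀ t ∈ M.Δ, ∀ r k B, t.update r = some (Sum.inr (k, B)) → B = 0

end ClassRegisterAutomaton

/-- The class of languages of non-guessing class register automata over `S`. -/
def CRAminus {A : Type u} {D : Type v} {m : ℕ} (S : Signature A D m) : Set (Set (Word A D m)) :=
  {L | ∃ M : ClassRegisterAutomaton S, M.NonGuessing ∧ M.lang = L}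

/-! ### Class automata -/

/-- Class automata: a non-deterministic letter-to-letter transducer from `A` to a finite working
alphabet `Γ`, given as a non-deterministic finite automaton over pairs (input letter, output
letter), and a finite automaton over `Γ × {0,1}^m`. -/
structure ClassAutomaton (A : Type u) (m : ℕ) where
  Γ : Type
  finite_Γ : Finite Γ
  QT : Type
  finite_QT : Finite QT
  transducer : NFA (A × Γ) QT
  QC : Type
  finite_QC : Finite QC
  classAut : NFA (Γ × (Fin m → Bool)) QC

open Classical in
/-- The recognized language: some output word of the transducer, marked with the positions and
components that carry `d`, is accepted by the class condition for every data value `d`. -/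
noncomputable def ClassAutomaton.lang {A : Type u} {m : ℕ} (M : ClassAutomaton A m)
    (D : Type v) : Set (Word A D m) :=
  {w | ∃ c : Pos w → M.Γ,
    List.ofFn (fun i : Pos w => (label w i, c i)) ∈ M.transducer.accepts ∧
    ∀ d : D, List.ofFn (fun i : Pos w => (c i, fun k => decide (dval w i k = d)))
      ∈ M.classAut.accepts}

/-- The class of languages recognized by class automata. -/
def ClassAut (A : Type u) (D : Type v) (m : ℕ) : Set (Set (Word A D m)) :=
  {L | ∃ M : ClassAutomaton A m, M.lang D = L}

/-! ### The signature of direct and data-class successors -/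

/-- The relation symbols `≺_{+1}` and `≺_∼^k`. -/
inductive SuccSimSym (m : ℕ) : Type
  | succ : SuccSimSym m
  | sim (k : Fin m) : SuccSimSym m

theorem SuccSimSym.finite (m : ℕ) : Finite (SuccSimSym m) := by
  refine Finite.of_injective
    (fun s : SuccSimSym m => match s with
      | SuccSimSym.succ => (none : Option (Fin m))
      | SuccSimSym.sim k => some k) ?_
  intro s t h
  cases s <;> cases t <;> simp_all

/-- `≺_{+1}` is the direct successor relation, `≺_∼^k` relates successive positions with the same
`k`-th data value. -/
def succSimRel {A : Type u} {D : Type v} {m : ℕ} (w : Word A D m) :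
    SuccSimSym m → Pos w → Pos w → Prop
  | SuccSimSym.succ, i, j => (j : ℕ) = (i : ℕ) + 1
  | SuccSimSym.sim k, i, j => i < j ∧ dval w i k = dval w j k ∧
      ¬ ∃ i', i < i' ∧ i' < j ∧ dval w i k = dval w i' k

/-- The signature with relation symbols `≺_{+1}`, `≺_∼^1`, …, `≺_∼^m`. -/
def succSim (A : Type u) (D : Type v) (m : ℕ) : Signature A D m where
  Sym := SuccSimSym m
  finite_sym := SuccSimSym.finite m
  rel := succSimRel
  lt_of_rel := by
    intro w s i j h
    cases s with
    | succ => exact Fin.lt_def.2 (by simp only [succSimRel] at h; omega)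
    | sim k => exact h.1
  out_unique := by
    intro w s i j j' h h'
    cases s with
    | succ => exact Fin.ext (by simp only [succSimRel] at h h'; omega)
    | sim k =>
      obtain ⟨h1, h2, h3⟩ := h
      obtain ⟨h1', h2', h3'⟩ := h'
      rcases lt_trichotomy j j' with hj | hj | hj
      · exact absurd ⟨j, h1, hj, h2⟩ h3'
      · exact hj
      · exact absurd ⟨j', h1', hj, h2'⟩ h3
  in_unique := by
    intro w s i i' j h h'
    cases s with
    | succ => exact Fin.ext (by simp only [succSimRel] at h h'; omega)
    | sim k =>
      obtain ⟨h1, h2, h3⟩ := h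
      obtain ⟨h1', h2', h3'⟩ := h'
      rcases lt_trichotomy i i' with hj | hj | hj
      · exact absurd ⟨i', hj, h1', h2.trans h2'.symm⟩ h3
      · exact hj
      · exact absurd ⟨i, hj, h1, h2'.trans h2.symm⟩ h3'
  monotone := by
    intro w s i j i' j' h h' hi _
    cases s with
    | succ =>
      simp only [succSimRel] at h h'
      rw [Fin.lt_def, Fin.lt_def]
      omega
    | sim k =>
      obtain ⟨h1, h2, h3⟩ := h
      obtain ⟨h1', h2', h3'⟩ := h'
      have e : dval w i k = dval w i' k := by simp only [dval, hi]
      constructor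
      · intro hlt
        by_contra hn
        exact h3 ⟨i', hlt, lt_of_lt_of_le h1' (not_lt.1 hn), e⟩
      · intro hlt
        by_contra hn
        rcases lt_or_eq_of_le (not_lt.1 hn) with hl | he
        · exact h3' ⟨i, hl, h1.trans hlt, e.symm⟩
        · subst he
          exact h3' ⟨j, h1, hlt, h2⟩

/-! ### The language -/

/-- The words `(a,1,1)…(a,n,n)(a,1,1)…(a,n,n)` with `n ≥ 1`, where the data value `e i` plays the
role of the number `i`. -/
def doubledWords {A : Type u} {D : Type v} (a : A) (e : ℕ ↪ D) : Set (Word A D 2) :=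
  {w | ∃ n : ℕ, 1 ≤ n ∧
    w = (List.range' 1 n).map (fun i => (a, fun _ => e i)) ++
      (List.range' 1 n).map (fun i => (a, fun _ => e i))}

end DataWords

/-! A word lies in the language exactly when every position is labeled `a` and has two equal data
values, the length is `2n` with `n ≥ 1`, and the class successor is the shift by `n` (`IsDoubled`).
Isomorphisms respect direct successor edges and therefore the numbering of positions, so the closure
adds only renamings of the values.

The shift is forced by local conditions (`isDoubled_iff_local`): every position has exactly one of a
class successor and a class predecessor, the positions with a class predecessor are closed under
direct successor, and class edges starting at neighbours end at neighbours. These conditions are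
first-order without comparison of data across positions, which gives membership in rEMSO with no set
quantifier at all.

A class register automaton marks the two halves by its states. The condition on neighbours is
checked at the end `j'` of a class edge from `j` to `j'`: a register at `j` still holds the value of
the position before `j`, and the guard compares it with the value of the position before `j'`.

A class automaton sees one data value at a time. If the first half has more positions than the class
condition has sets of states, two values, each marked in the first half, lead to the same set.
Swapping these values in the second half only preserves acceptance for every value, but the order of
the copies is now violated. -/

namespace DataWords

/-! ### Doubled words: global and local descriptions, closure under equivalence -/

section Characterization

variable {A : Type*} {D : Type*}

/-- The words that consist of two copies of a sequence of `n` pairwise distinct values, with label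
`a` throughout and equal data values at each position. -/
def IsDoubled (a : A) (w : Word A D 2) : Prop :=
  (∀ i, label w i = a ∧ dval w i 0 = dval w i 1) ∧
  ∃ n : ℕ, 1 ≤ n ∧ w.length = 2 * n ∧
    ∀ i j : Pos w, succSimRel w (.sim 0) i j ↔ (j : ℕ) = i + n

/-- If the two data values agree at each position, both class successor relations agree. -/
theorem succSimRel_sim_iff {w : Word A D 2} (h : ∀ i, dval w i 0 = dval w i 1) (k : Fin 2)
    (i j : Pos w) : succSimRel w (.sim k) i j ↔ succSimRel w (.sim 0) i j := by
  fin_cases k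
  · rfl
  · simp [succSimRel, h]

/-- The last position before `j` with the value of `j` is its class predecessor. -/
theorem exists_succSimRel_sim_of_lt {m : ℕ} {w : Word A D m} {k : Fin m} {i j : Pos w}
    (hij : i < j) (h : dval w i k = dval w j k) : ∃ i', succSimRel w (.sim k) i' j := by
  classical
  let s : Finset (Pos w) := Finset.univ.filter fun i' => i' < j ∧ dval w i' k = dval w j k
  have hs : s.Nonempty := ⟨i, by simp [s, hij, h]⟩
  have hm := s.max'_mem hs
  simp only [s, Finset.mem_filter, Finset.mem_univ, true_and] at hm
  refine ⟨s.max' hs, hm.1, hm.2, ?_⟩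
  rintro ⟨i', h1, h2, h3⟩
  exact absurd (s.le_max' i' (by simp [s, h2, ← h3, hm.2])) (not_le.2 h1)

/-- Doubled words are described by conditions on neighbouring positions. -/
theorem isDoubled_iff_local (a : A) (w : Word A D 2) :
    IsDoubled a w ↔ (∃ _ : Pos w, True) ∧
      (∀ i, label w i = a ∧ dval w i 0 = dval w i 1) ∧
      (∀ i, (∃ j, succSimRel w (.sim 0) i j) ↔ ¬ ∃ j, succSimRel w (.sim 0) j i) ∧
      (∀ i j, succSimRel w .succ i j → (∃ k, succSimRel w (.sim 0) k i) →
        ∃ k, succSimRel w (.sim 0) k j) ∧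
      (∀ i j i' j', succSimRel w .succ i j → succSimRel w (.sim 0) i i' →
        succSimRel w (.sim 0) j j' → succSimRel w .succ i' j') := by
  constructor
  · rintro ⟨h, n, hn, hl, hr⟩
    refine ⟨⟨⟨0, by omega⟩, trivial⟩, h, ?_, ?_, ?_⟩
    · intro i
      simp only [hr]
      have hi := i.isLt
      constructor
      · rintro ⟨j, hj⟩ ⟨k, hk⟩
        have := j.isLt
        omega
      · intro hk
        by_cases hin : (i : ℕ) < n
        · exact ⟨⟨i + n, by omega⟩, rfl⟩
        · exact absurd ⟨⟨i - n, by omega⟩, by simp only; omega⟩ hk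
    · intro i j hij
      simp only [hr]
      rintro ⟨k, hk⟩
      have := j.isLt
      simp only [succSimRel] at hij
      exact ⟨⟨k + 1, by omega⟩, by simp only; omega⟩
    · intro i j i' j' hij hi hj
      simp only [hr] at hi hj
      simp only [succSimRel] at hij ⊢
      omega
  · rintro ⟨⟨x, -⟩, h, h1, h2, h3⟩
    refine ⟨h, ?_⟩
    have hx := x.isLt
    have hlt : ∀ i j, succSimRel w (.sim 0) i j → (i : ℕ) < j := fun i j h => h.1
    have hou : ∀ i j j', succSimRel w (.sim 0) i j → succSimRel w (.sim 0) i j' → j = j' :=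
      (succSim A D 2).out_unique w (.sim 0)
    -- The first position has no class predecessor, hence a class successor `p`; this `p` will be
    -- the length `n` of each half.
    obtain ⟨p, hp⟩ := (h1 ⟨0, by omega⟩).2 (by
      rintro ⟨j, hj⟩
      exact absurd (hlt _ _ hj) (Nat.not_lt_zero _))
    have hp0 := hlt _ _ hp
    simp only at hp0
    have key : ∀ (i : ℕ) (hi : i < w.length) (j : Pos w),
        succSimRel w (.sim 0) ⟨i, hi⟩ j → (j : ℕ) = i + p := by
      intro i
      induction i with
      | zero => intro hi j hj; rw [hou _ _ _ hj hp]; omega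
      | succ i ih =>
        intro hi j hj
        have hi' : i < w.length := by omega
        have hs : succSimRel w .succ ⟨i, hi'⟩ ⟨i + 1, hi⟩ := rfl
        -- Position `i` has a class successor: otherwise it has a class predecessor, then so does `i
        -- + 1`, which already has a class successor.
        obtain ⟨j', hj'⟩ := (h1 ⟨i, hi'⟩).2 fun hk => (h1 ⟨i + 1, hi⟩).1 ⟨j, hj⟩ (h2 _ _ hs hk)
        have e1 := ih hi' j' hj'
        have e2 := h3 _ _ _ _ hs hj' hj
        simp only [succSimRel] at e2
        omega
    have key' : ∀ i j : Pos w, succSimRel w (.sim 0) i j → (j : ℕ) = i + p :=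
      fun i j => key i i.isLt j
    have next : ∀ i : Pos w, (i : ℕ) < p → ∃ j, succSimRel w (.sim 0) i j := by
      intro i hi
      refine (h1 i).2 ?_
      rintro ⟨j, hj⟩
      have := key' _ _ hj
      omega
    -- The class successor of `p - 1` is `2p - 1`, which must be a position.
    have hle : 2 * (p : ℕ) ≤ w.length := by
      have hpl := p.isLt
      obtain ⟨j, hj⟩ := next ⟨p - 1, by omega⟩ (by simp only; omega)
      have := key' _ _ hj
      have := j.isLt
      simp only at *
      omega
    have prev : ∀ (c : ℕ) (hc : p + c < w.length), ∃ j, succSimRel w (.sim 0) j ⟨p + c, hc⟩ := by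
      intro c
      induction c with
      | zero => intro _; exact ⟨_, hp⟩
      | succ c ih => intro hc; exact h2 ⟨p + c, by omega⟩ _ rfl (ih (by omega))
    -- A position `2p` would have `p` as class predecessor, but `p` is itself a class successor, of
    -- the first position.
    have hge : ¬ 2 * (p : ℕ) < w.length := by
      intro hl
      obtain ⟨j, hj⟩ := prev p (by omega)
      have e := key' _ _ hj
      have hjp : j = p := Fin.ext (by simp only at e; omega)
      rw [hjp] at hj
      exact (h1 p).1 ⟨_, hj⟩ ⟨_, hp⟩
    refine ⟨p, hp0, by omega, fun i j => ⟨key' i j, fun e => ?_⟩⟩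
    have := j.isLt
    obtain ⟨j', hj'⟩ := next i (by omega)
    have e' := key' _ _ hj'
    rwa [show j = j' from Fin.ext (by omega)]

/-- The word `(a,f 0,f 0)…(a,f (n-1),f (n-1))(a,g 0,g 0)…(a,g (n-1),g (n-1))`. -/
def twoHalves (a : A) (n : ℕ) (f g : ℕ → D) : Word A D 2 :=
  (List.range n).map (fun i => (a, fun _ => f i)) ++ (List.range n).map (fun i => (a, fun _ => g i))

theorem length_twoHalves (a : A) (n : ℕ) (f g : ℕ → D) :
    (twoHalves a n f g).length = 2 * n := by
  simp [twoHalves]; omega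

theorem twoHalves_get (a : A) (n : ℕ) (f g : ℕ → D) (i : Pos (twoHalves a n f g)) :
    (twoHalves a n f g).get i = (a, fun _ => if (i : ℕ) < n then f i else g (i - n)) := by
  have key : ∀ (i : ℕ) (hi : i < ((List.range n).map (fun i => (a, fun _ : Fin 2 => f i)) ++
      (List.range n).map (fun i => (a, fun _ : Fin 2 => g i))).length),
      ((List.range n).map (fun i => (a, fun _ : Fin 2 => f i)) ++
        (List.range n).map (fun i => (a, fun _ : Fin 2 => g i)))[i] =
      (a, fun _ => if i < n then f i else g (i - n)) := by
    intro i hi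
    by_cases h : i < n <;> simp [List.getElem_append, h]
  exact key i i.isLt

theorem label_twoHalves (a : A) (n : ℕ) (f g : ℕ → D) (i : Pos (twoHalves a n f g)) :
    label (twoHalves a n f g) i = a := by
  rw [label, twoHalves_get]

theorem dval_twoHalves (a : A) (n : ℕ) (f g : ℕ → D) (i : Pos (twoHalves a n f g)) (k : Fin 2) :
    dval (twoHalves a n f g) i k = if (i : ℕ) < n then f i else g (i - n) := by
  rw [dval, twoHalves_get]

/-- By injectivity each value occurs exactly twice, at distance `n`, so no third occurrence can come
between. -/
theorem isDoubled_twoHalves (a : A) {n : ℕ} (hn : 1 ≤ n) {f : ℕ → D} (hf : f.Injective) :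
    IsDoubled a (twoHalves a n f f) := by
  refine ⟨fun i => ⟨label_twoHalves .., by simp only [dval_twoHalves]⟩, n, hn,
    length_twoHalves .., fun i j => ?_⟩
  have heq : ∀ i j : Pos (twoHalves a n f f), i < j →
      (dval (twoHalves a n f f) i 0 = dval (twoHalves a n f f) j 0 ↔ (j : ℕ) = i + n) := by
    intro i j hij
    have hi := i.isLt.trans_eq (length_twoHalves ..)
    have hj := j.isLt.trans_eq (length_twoHalves ..)
    rw [Fin.lt_def] at hij
    rw [dval_twoHalves, dval_twoHalves]
    split_ifs <;> rw [hf.eq_iff] <;> omega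
  constructor
  · rintro ⟨h1, h2, -⟩
    exact (heq i j h1).1 h2
  · intro h
    have hlt : i < j := by rw [Fin.lt_def]; omega
    refine ⟨hlt, (heq i j hlt).2 h, ?_⟩
    rintro ⟨i', h1, h2, h3⟩
    have := (heq i i' h1).1 h3
    rw [Fin.lt_def] at h2
    omega

theorem mem_doubledWords_iff (a : A) (e : ℕ ↪ D) (w : Word A D 2) :
    w ∈ doubledWords a e ↔
      ∃ n, 1 ≤ n ∧ w = twoHalves a n (fun i => e (i + 1)) (fun i => e (i + 1)) := by
  simp only [doubledWords, twoHalves, Set.mem_ofPred_eq, List.range'_eq_map_range, List.map_map,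
    Function.comp_def, Nat.add_comm]

/-- Isomorphisms between graphs of words preserve the numbering of positions. -/
theorem equiv_val_eq {w w' : Word A D 2} (h : Pos w ≃ Pos w')
    (hs : ∀ i j : Pos w, succSimRel w .succ i j ↔ succSimRel w' .succ (h i) (h j)) :
    ∀ i : Pos w, (h i : ℕ) = i := by
  rintro ⟨i, hi⟩
  induction i with
  | zero =>
    by_contra hne
    have hlt := (h ⟨0, hi⟩).isLt
    simp only at hne
    have := (hs (h.symm ⟨(h ⟨0, hi⟩ : ℕ) - 1, by omega⟩) ⟨0, hi⟩).2
      (by simp only [succSimRel, Equiv.apply_symm_apply]; omega)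
    simp [succSimRel] at this
  | succ i ih =>
    have e := ih (by omega)
    have := (hs ⟨i, by omega⟩ ⟨i + 1, hi⟩).1 rfl
    simp only [succSimRel] at this e ⊢
    omega

/-- Any isomorphism is the identity on position numbers, so class edges and the partitions carry
over literally. Conversely, `IsDoubled` determines all edges, labels and partitions from `n`, so
matching lengths suffice. -/
theorem mem_equivClosure_doubledWords_iff (a : A) (e : ℕ ↪ D) (w : Word A D 2) :
    w ∈ equivClosure (succSim A D 2) (doubledWords a e) ↔ IsDoubled a w := by
  have hinj : Function.Injective fun i => e (i + 1) := fun i j h => by simpa using h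
  constructor
  · rintro ⟨w', hw', (h : Pos w ≃ Pos w'), hedge, hlab, hpart⟩
    obtain ⟨n, hn, rfl⟩ := (mem_doubledWords_iff a e w').1 hw'
    obtain ⟨h1, n', hn', hl, hr⟩ := isDoubled_twoHalves a hn hinj
    have hv := equiv_val_eq h (hedge .succ)
    have hlen : w.length = (twoHalves a n (fun i => e (i + 1)) (fun i => e (i + 1))).length := by
      simpa using Fintype.card_congr h
    refine ⟨fun i => ⟨(hlab i).trans (h1 _).1, ?_⟩, n', hn', hlen.trans hl, fun i j => ?_⟩
    · have hp : Setoid.ker (dval w i) = Setoid.ker (dval _ (h i)) := hpart i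
      have : Setoid.ker (dval w i) 0 1 := by
        rw [hp]
        exact (h1 _).2
      exact this
    · rw [← hv i, ← hv j, ← hr]
      exact hedge (.sim 0) i j
  · rintro ⟨h1, n, hn, hl, hr⟩
    refine ⟨_, (mem_doubledWords_iff a e _).2 ⟨n, hn, rfl⟩, ?_⟩
    have hlen := hl.trans (length_twoHalves a n (fun i => e (i + 1)) (fun i => e (i + 1))).symm
    obtain ⟨h1', n', hn', hl', hr'⟩ := isDoubled_twoHalves a hn hinj
    obtain rfl : n = n' := by omega
    refine ⟨finCongr hlen, ?_, fun i => (h1 i).1.trans (h1' _).1.symm, fun i => ?_⟩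
    · intro s i j
      cases s with
      | succ => exact Iff.rfl
      | sim k =>
        exact (succSimRel_sim_iff (fun i => (h1 i).2) k i j).trans ((hr i j).trans
          ((hr' (finCongr hlen i) (finCongr hlen j)).symm.trans (succSimRel_sim_iff (fun i => (h1' i).2) k _ _).symm))
    · refine Setoid.ext fun k l => ?_
      have e1 : ∀ k, dval w i k = dval w i 0 := by
        intro k; fin_cases k
        exacts [rfl, (h1 i).2.symm]
      change dval w i k = dval w i l ↔ dval _ (finCongr hlen i) k = dval _ (finCongr hlen i) l
      rw [e1 k, e1 l, dval_twoHalves, dval_twoHalves]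
      simp

end Characterization

/-! ### Definability in the restricted logic -/

section Logic

variable {A : Type*} {D : Type*}

namespace MSO

variable {m : ℕ} {S : Signature A D m}

def and (φ ψ : MSO S) : MSO S := neg (or (neg φ) (neg ψ))

def imp (φ ψ : MSO S) : MSO S := or (neg φ) ψ

def all (x : ℕ) (φ : MSO S) : MSO S := neg (exFO x (neg φ))

theorem sat_and (w : Word A D m) (φ ψ : MSO S) (α : ℕ → Option (Pos w)) (β : ℕ → Set (Pos w)) :
    (and φ ψ).Sat w α β ↔ φ.Sat w α β ∧ ψ.Sat w α β := by
  simp only [and, Sat]; tauto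

theorem sat_imp (w : Word A D m) (φ ψ : MSO S) (α : ℕ → Option (Pos w)) (β : ℕ → Set (Pos w)) :
    (imp φ ψ).Sat w α β ↔ (φ.Sat w α β → ψ.Sat w α β) := by
  simp only [imp, Sat]; tauto

theorem sat_all (w : Word A D m) (x : ℕ) (φ : MSO S) (α : ℕ → Option (Pos w))
    (β : ℕ → Set (Pos w)) :
    (all x φ).Sat w α β ↔ ∀ i : Pos w, φ.Sat w (Function.update α x (some i)) β := by
  simp [all, Sat]

/-- The first-order sentence for the doubled words. -/
def doubled (a : A) : MSO (succSim A D 2) :=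
  let su : ℕ → ℕ → MSO (succSim A D 2) := rel (S := succSim A D 2) SuccSimSym.succ
  let si : ℕ → ℕ → MSO (succSim A D 2) := rel (S := succSim A D 2) (SuccSimSym.sim 0)
  and (exFO 0 (eq 0 0)) <|
  and (all 0 (and (lab 0 a) (dataEq 0 0 1 0))) <|
  and (all 0 (and (imp (exFO 1 (si 0 1)) (neg (exFO 1 (si 1 0))))
    (imp (neg (exFO 1 (si 1 0))) (exFO 1 (si 0 1))))) <|
  and (all 0 (all 1 (imp (su 0 1) (imp (exFO 2 (si 2 0)) (exFO 2 (si 2 1))))))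
    (all 0 (all 1 (all 2 (all 3 (imp (su 0 1) (imp (si 0 2) (imp (si 1 3) (su 2 3))))))))

theorem lang_doubled (a : A) : (doubled (D := D) a).lang = {w | IsDoubled a w} := by
  ext w
  rw [Set.mem_ofPred_eq, isDoubled_iff_local]
  simp only [lang, doubled, Set.mem_ofPred_eq, sat_and, sat_imp, sat_all]
  simp [Sat, succSim, iff_iff_implies_and_implies]

theorem isSentence_doubled (a : A) : (doubled (D := D) a).IsSentence := by
  constructor <;>
  · ext x
    simp [doubled, freeFO, freeSO, and, imp, all]
    try omega

theorem isFO_doubled (a : A) : (doubled (D := D) a).IsFO := by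
  simp [doubled, IsFO, and, imp, all]

theorem isLocal_doubled (a : A) : (doubled (D := D) a).IsLocal := by
  simp [doubled, IsLocal, and, imp, all]

end MSO

theorem setOf_isDoubled_mem_rEMSO (a : A) :
    {w : Word A D 2 | IsDoubled a w} ∈ rEMSO (succSim A D 2) :=
  ⟨MSO.doubled a, MSO.isSentence_doubled a, .ofFO _ (MSO.isFO_doubled a), MSO.isLocal_doubled a,
    MSO.lang_doubled a⟩

end Logic

/-! ### Class automata: pigeonhole and swapping -/

section ClassAutomata

variable {A : Type*} {D : Type*}

theorem ofFn_twoHalves {X : Type*} (a : A) (n : ℕ) (f g : ℕ → D)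
    (F : Pos (twoHalves a n f g) → X) (hl : n + n = (twoHalves a n f g).length) :
    List.ofFn F = List.ofFn (fun i : Fin n => F (Fin.cast hl (i.castAdd n))) ++
      List.ofFn (fun i : Fin n => F (Fin.cast hl (i.natAdd n))) := by
  rw [List.ofFn_congr hl.symm F, List.ofFn_add]
  rfl

/-- No class automaton recognizes the doubled words: swapping two values in the second half is not
noticed by the class condition if the first half, marked at either value, leads to the same
states. -/
theorem setOf_isDoubled_notMem_classAut (a : A) (e : ℕ ↪ D) :
    {w : Word A D 2 | IsDoubled a w} ∉ ClassAut A D 2 := by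
  classical
  rintro ⟨M, hM⟩
  have := M.finite_QC
  obtain ⟨n, ⟨hn⟩⟩ : ∃ n : ℕ, Nonempty (Set M.QC ≃ Fin n) :=
    ⟨_, ⟨Finite.equivFin (Set M.QC)⟩⟩
  -- One more position per half than there are sets of states of the class condition.
  obtain ⟨N, hN⟩ : ∃ N, N = n + 1 := ⟨_, rfl⟩
  obtain ⟨c, hc, hd⟩ : twoHalves a N e e ∈ M.lang D :=
    hM ▸ isDoubled_twoHalves a (by omega) e.injective
  have hl : N + N = (twoHalves a N e e).length := by
    rw [length_twoHalves]; omega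
  let first : D → List (M.Γ × (Fin 2 → Bool)) := fun d =>
    List.ofFn fun i : Fin N =>
      (c (Fin.cast hl (i.castAdd N)), fun _ => decide (e i = d))
  let second : (ℕ → D) → D → List (M.Γ × (Fin 2 → Bool)) := fun g d =>
    List.ofFn fun i : Fin N =>
      (c (Fin.cast hl (i.natAdd N)), fun _ => decide (g i = d))
  have hacc : ∀ d, first d ++ second e d ∈ M.classAut.accepts := by
    intro d
    have := hd d
    rw [ofFn_twoHalves (hl := hl)] at this
    simpa [dval_twoHalves, first, second] using this
  obtain ⟨i, j, hij, hs⟩ := Fintype.exists_ne_map_eq_of_card_lt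
    (fun i : Fin N => hn (M.classAut.eval (first (e i)))) (by simp [hN])
  replace hs := hn.injective hs
  have hij' : (i : ℕ) ≠ j := fun h => hij (Fin.ext h)
  let σ : Equiv.Perm ℕ := Equiv.swap i j
  -- Marked at `e i`, the swapped second half looks like the original one marked at `e j`, and vice
  -- versa; the first halves for these two marks are interchangeable by `hs`. For other values the
  -- marking is unchanged.
  have hacc' : ∀ d, first d ++ second (e ∘ σ) d ∈ M.classAut.accepts := by
    have heval : ∀ x y, x ++ y ∈ M.classAut.accepts ↔
        ∃ q ∈ M.classAut.accept, q ∈ M.classAut.evalFrom (M.classAut.eval x) y := by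
      intro x y
      rw [NFA.mem_accepts, NFA.evalFrom_append]
      rfl
    intro d
    have hsecond : ∀ d', (∀ k, e (σ k) = d ↔ e k = d') → second (e ∘ σ) d = second e d' := by
      intro d' h
      simp [second, h]
    by_cases hdi : d = e i
    · subst hdi
      rw [hsecond (e j) (by simp [σ, Equiv.swap_apply_eq_iff]), heval, hs, ← heval]
      exact hacc _
    by_cases hdj : d = e j
    · subst hdj
      rw [hsecond (e i) (by simp [σ, Equiv.swap_apply_eq_iff]), heval, ← hs, ← heval]
      exact hacc _
    rw [hsecond d]
    · exact hacc d
    · intro k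
      simp only [σ, Equiv.swap_apply_def]
      split_ifs with h1 h2
      · subst h1; simp [Ne.symm hdi, Ne.symm hdj]
      · subst h2; simp [Ne.symm hdi, Ne.symm hdj]
      · rfl
  -- The transducer reads only labels, so its output `c` remains valid after the swap.
  have hmem : twoHalves a N e (e ∘ σ) ∈ M.lang D := by
    have hl' : (twoHalves a N e (e ∘ σ)).length = (twoHalves a N e e).length := by
      simp only [length_twoHalves]
    refine ⟨fun i => c (Fin.cast hl' i), ?_, fun d => ?_⟩
    · rw [List.ofFn_congr hl'.symm] at hc
      simpa [label_twoHalves] using hc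
    · rw [ofFn_twoHalves (hl := hl.trans hl'.symm)]
      simpa [dval_twoHalves, first, second] using hacc' d
  rw [hM] at hmem
  obtain ⟨-, n', -, hl', hr⟩ := hmem
  rw [length_twoHalves] at hl'
  have hlen := length_twoHalves a N e (e ∘ σ)
  have hi := i.isLt
  -- Position `i` of the second half now carries `e j`, although the shift demands `e i`.
  obtain ⟨-, h, -⟩ := (hr ⟨i, by omega⟩ ⟨i + n', by omega⟩).2 rfl
  rw [dval_twoHalves, dval_twoHalves] at h
  have hn' : N = n' := by omega
  subst hn'
  simp [σ, hi] at h
  exact hij' h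

end ClassAutomata

/-! ### A non-guessing class register automaton -/

section Automaton

variable {A : Type*} {D : Type*}

/-- The transitions of the automaton for the doubled words. State `0` marks the first position,
state `1` the rest of the first half, state `2` the second half. Register `true` holds the data
value of the position itself, register `false` the one of the preceding position. -/
def doubledTransition (a : A) (D : Type*) (x y : Option (Fin 3)) (q : Fin 3) :
    Transition (succSim A D 2) (Fin 3) Bool where
  source := fun (s : SuccSimSym 2) => match s with
    | .succ => x
    | .sim _ => y
  -- The register comparison is required only after a position in state `2`, that is, not at the
  -- first position of the second half.
  guard := .and (.atom (.inl 0, .inl 1)) <|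
    if h : x = some 2 ∧ y.isSome then
      .atom (.inr (⟨SuccSimSym.sim 0, h.2⟩, false), .inr (⟨SuccSimSym.succ, by simp [h.1]⟩, true))
    else .tt
  letter := a
  target := q
  update := fun r => if r then some (.inr (0, 0)) else
    if h : x.isSome then some (.inl (⟨SuccSimSym.succ, h⟩, true)) else none

theorem sphereValues_zero {m : ℕ} (S : Signature A D m) (w : Word A D m) (k : Fin m) (i : Pos w) :
    sphereValues S w 0 k i = {dval w i k} := by
  ext d
  simp only [sphereValues, Set.mem_ofPred_eq, Set.mem_singleton_iff, Nat.cast_zero,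
    nonpos_iff_eq_zero]
  constructor
  · rintro ⟨j, h, rfl⟩
    rw [SimpleGraph.edist_eq_zero_iff.1 h]
  · rintro rfl
    exact ⟨i, SimpleGraph.edist_self, rfl⟩

theorem doubledTransition_fires_iff (a : A) (x y : Option (Fin 3)) (q : Fin 3) (w : Word A D 2)
    (st : Pos w → Fin 3) (ρ : Pos w → Bool → Option D) (i : Pos w) :
    (doubledTransition a D x y q).Fires w st ρ i ↔
      a = label w i ∧ q = st i ∧ x = (prev (succSim A D 2) w SuccSimSym.succ i).map st ∧
      (∀ k, y = (prev (succSim A D 2) w (SuccSimSym.sim k) i).map st) ∧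
      dval w i 0 = dval w i 1 ∧
      (x = some 2 → y.isSome → ∃ d,
        (prev (succSim A D 2) w (SuccSimSym.sim 0) i).bind (fun j => ρ j false) = some d ∧
        (prev (succSim A D 2) w SuccSimSym.succ i).bind (fun j => ρ j true) = some d) ∧
      ρ i true = some (dval w i 0) ∧
      ρ i false = (prev (succSim A D 2) w SuccSimSym.succ i).bind (fun j => ρ j true) := by
  have hsrc : (∀ s, (doubledTransition a D x y q).source s = (prev (succSim A D 2) w s i).map st) ↔
      x = (prev (succSim A D 2) w SuccSimSym.succ i).map st ∧
      ∀ k, y = (prev (succSim A D 2) w (SuccSimSym.sim k) i).map st := by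
    constructor
    · intro h
      exact ⟨h SuccSimSym.succ, fun k => h (SuccSimSym.sim k)⟩
    · rintro ⟨h1, h2⟩ (_ | k)
      exacts [h1, h2 k]
  have hguard : (doubledTransition a D x y q).guard.Eval
        (fun θ => ∃ d : D, termVal w ρ i θ.1 = some d ∧ termVal w ρ i θ.2 = some d) ↔
      dval w i 0 = dval w i 1 ∧
      (x = some 2 → y.isSome → ∃ d,
        (prev (succSim A D 2) w (SuccSimSym.sim 0) i).bind (fun j => ρ j false) = some d ∧
        (prev (succSim A D 2) w SuccSimSym.succ i).bind (fun j => ρ j true) = some d) := by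
    simp only [doubledTransition, BoolFormula.Eval]
    refine and_congr (by simp [termVal, eq_comm]) ?_
    split_ifs with h
    · simp only [BoolFormula.Eval, termVal]
      exact ⟨fun h' _ _ => h', fun h' => h' h.1 h.2⟩
    · simp only [BoolFormula.Eval, true_iff]
      exact fun h1 h2 => absurd ⟨h1, h2⟩ h
  have htrue : UpdateOK w ρ i ((doubledTransition a D x y q).update true) (ρ i true) ↔
      ρ i true = some (dval w i 0) := by
    simp [doubledTransition, UpdateOK, sphereValues_zero]
  -- Whether the update is defined depends on `x`, so its agreement with the actual direct
  -- predecessor is needed here.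
  have hfalse : x = (prev (succSim A D 2) w SuccSimSym.succ i).map st →
      (UpdateOK w ρ i ((doubledTransition a D x y q).update false) (ρ i false) ↔
      ρ i false = (prev (succSim A D 2) w SuccSimSym.succ i).bind (fun j => ρ j true)) := by
    intro hx
    by_cases h : x.isSome
    · simp [doubledTransition, UpdateOK, h]
    · have hp : prev (succSim A D 2) w SuccSimSym.succ i = none := by simpa [hx] using h
      simp [doubledTransition, UpdateOK, h, hp]
  rw [Transition.Fires, hsrc, hguard, Bool.forall_bool, htrue]
  change a = label w i ∧ q = st i ∧ _ ↔ _
  tauto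

/-- A non-guessing class register automaton for the doubled words. -/
def doubledAutomaton (a : A) (D : Type*) : ClassRegisterAutomaton (succSim A D 2) where
  Q := Fin 3
  finite_Q := inferInstance
  R := Bool
  finite_R := inferInstance
  -- Each triple consists of the state at the direct predecessor, the common state at both class
  -- predecessors, and the target. The triple `(some 0, some 0, 2)` serves the case `n = 1`.
  Δ := (fun t => doubledTransition a D t.1 t.2.1 t.2.2) ''
    {(none, none, 0), (some 0, none, 1), (some 1, none, 1), (some 0, some 0, 2),
      (some 1, some 0, 2), (some 2, some 1, 2)}
  finite_Δ := (Set.toFinite _).image _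
  F := fun (s : SuccSimSym 2) => match s with
    | .succ => Set.univ
    | .sim _ => {2}
  -- State `0` must occur, which excludes the empty word.
  Φ := .neg (.atom (0, 0))

theorem nonGuessing_doubledAutomaton (a : A) : (doubledAutomaton a D).NonGuessing := by
  rintro _ ⟨t, -, rfl⟩ r k B h
  cases r
  · simp only [doubledTransition] at h
    by_cases hx : t.1.isSome
    · simp only [hx, dite_true] at h
      cases Option.some.inj h
    · simp [hx] at h
  · have h' : (0, 0) = (k, B) := Sum.inr.inj (Option.some.inj h)
    exact (Prod.ext_iff.1 h').2.symm

theorem prev_eq_none_iff {m : ℕ} (S : Signature A D m) (w : Word A D m) (s : S.Sym) (i : Pos w) :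
    prev S w s i = none ↔ ¬ ∃ j, S.rel w s j i := by
  simp only [Option.eq_none_iff_forall_ne_some, ne_eq, prev_eq_some_iff, not_exists]

/-- State `2` marks exactly the positions with a class predecessor, and class predecessors are never
in state `2`. With the local final states this gives the first local conditions; the register
comparison gives the one on neighbours. -/
theorem isDoubled_of_mem_lang (a : A) {w : Word A D 2} (hw : w ∈ (doubledAutomaton a D).lang) :
    IsDoubled a w := by
  obtain ⟨(st : Pos w → Fin 3), (ρ : Pos w → Bool → Option D), hrun, hF, hΦ⟩ := hw
  replace hrun : ∀ i, ∃ t ∈ ({(none, none, 0), (some 0, none, 1), (some 1, none, 1),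
      (some 0, some 0, 2), (some 1, some 0, 2), (some 2, some 1, 2)} :
        Set (Option (Fin 3) × Option (Fin 3) × Fin 3)),
      (doubledTransition a D t.1 t.2.1 t.2.2).Fires w st ρ i := by
    intro i
    obtain ⟨_, ⟨t, ht, rfl⟩, hf⟩ := hrun i
    exact ⟨t, ht, hf⟩
  have htrans : ∀ t ∈ ({(none, none, 0), (some 0, none, 1), (some 1, none, 1),
      (some 0, some 0, 2), (some 1, some 0, 2), (some 2, some 1, 2)} :
        Set (Option (Fin 3) × Option (Fin 3) × Fin 3)),
      (t.2.2 = 2 ↔ t.2.1 ≠ none) ∧ t.2.1 ≠ some 2 ∧ (t.2.1 = some 1 → t.1 = some 2) ∧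
        (t.1 ≠ none → t.2.2 ≠ 0) ∧ (t.1 = some 2 → t.2.2 = 2) := by
    rintro t (rfl | rfl | rfl | rfl | rfl | rfl) <;> decide
  simp only [doubledTransition_fires_iff] at hrun
  have hrel : ∀ s i j, prev (succSim A D 2) w s j = some i ↔ succSimRel w s i j :=
    fun s i j => prev_eq_some_iff _ w s j i
  have hnone : ∀ s j, prev (succSim A D 2) w s j = none ↔ ¬ ∃ i, succSimRel w s i j :=
    fun s j => prev_eq_none_iff _ w s j
  have hFs : ∀ i, st i ≠ 2 → ∃ j, succSimRel w (.sim 0) i j := by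
    intro i hi
    by_contra hn
    exact hi (hF i (SuccSimSym.sim 0) hn)
  have hprev : ∀ i j, succSimRel w (.sim 0) i j → st j = 2 ∧ st i ≠ 2 := by
    intro i j hij
    obtain ⟨t, ht, -, h2, -, h4, -⟩ := hrun j
    have h40 := h4 0
    rw [(hrel _ _ _).2 hij, Option.map_some] at h40
    obtain ⟨k1, k2, -⟩ := htrans t ht
    rw [← h2, k1]
    exact ⟨by simp [h40], fun h => k2 (h40.trans (congrArg some h))⟩
  have hprev' : ∀ j, st j = 2 → ∃ i, succSimRel w (.sim 0) i j := by
    intro j hj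
    by_contra hn
    obtain ⟨t, ht, -, h2, -, h4, -⟩ := hrun j
    have h40 := h4 0
    rw [(hnone _ _).2 hn] at h40
    exact (htrans t ht).1.1 (h2.trans hj) h40
  have hsucc : ∀ i j, succSimRel w .succ i j → st j ≠ 0 ∧ (st i = 2 → st j = 2) := by
    intro i j hij
    obtain ⟨t, ht, -, h2, h3, -⟩ := hrun j
    rw [(hrel _ _ _).2 hij, Option.map_some] at h3
    obtain ⟨-, -, -, k4, k5⟩ := htrans t ht
    rw [← h2]
    exact ⟨k4 (by simp [h3]), fun h => k5 (h3.trans (congrArg some h))⟩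
  have hreg : ∀ i, ρ i true = some (dval w i 0) := by
    intro i
    obtain ⟨t, ht, -, -, -, -, -, -, h, -⟩ := hrun i
    exact h
  have hdv : ∀ i, label w i = a ∧ dval w i 0 = dval w i 1 := by
    intro i
    obtain ⟨t, ht, h1, -, -, -, h, -⟩ := hrun i
    exact ⟨h1.symm, h⟩
  refine (isDoubled_iff_local a w).2 ⟨?_, hdv, ?_, ?_, ?_⟩
  · by_contra hn
    apply hΦ
    have : {i : Pos w | st i = 0} = ∅ := by
      ext i
      exact absurd ⟨i, trivial⟩ hn
    change {i : Pos w | st i = 0}.ncard ≤ 0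
    rw [this, Set.ncard_empty]
  · intro i
    constructor
    · rintro ⟨j, hj⟩ ⟨k, hk⟩
      exact (hprev _ _ hj).2 (hprev _ _ hk).1
    · intro hn
      exact hFs i fun h => hn (hprev' i h)
  · rintro i j hij ⟨k, hk⟩
    exact hprev' j ((hsucc i j hij).2 (hprev _ _ hk).1)
  · intro i j i' j' hij hii hjj
    -- State `1` at `j` forces state `2` at the direct predecessor `z` of `j'`, so the guard
    -- compares registers there and yields that `z` and `i` have the same value.
    have hj1 : st j = 1 := by
      have h1 := (hsucc i j hij).1
      have h2 := (hprev _ _ hjj).2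
      omega
    obtain ⟨t, ht, -, -, h3, h4, -, h6, -⟩ := hrun j'
    have h40 := h4 0
    rw [(hrel _ _ _).2 hjj, Option.map_some, hj1] at h40
    obtain ⟨hx, hy⟩ : t.1 = some 2 ∧ t.2.1.isSome :=
      ⟨(htrans t ht).2.2.1 h40, by simp [h40]⟩
    obtain ⟨d, hd, hd'⟩ := h6 hx hy
    obtain ⟨z, hz, hz2⟩ := Option.map_eq_some_iff.1 (h3.symm.trans hx)
    rw [hz, Option.bind_some, hreg] at hd'
    obtain ⟨tj, -, -, -, -, -, -, -, -, hj⟩ := hrun j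
    rw [(hrel _ _ _).2 hjj, Option.bind_some, hj, (hrel _ _ _).2 hij, Option.bind_some, hreg,
      ← hd', Option.some_inj] at hd
    -- The class predecessor `p` of `z` shares its value with `i`. If they were distinct, the later
    -- one would have a class predecessor and be in state `2`; hence `p = i` and `z = i'`.
    obtain ⟨p, hp⟩ := hprev' z hz2
    have hpi : dval w p 0 = dval w i 0 := hp.2.1.trans hd.symm
    have hip : p = i := by
      rcases lt_trichotomy p i with h | h | h
      · obtain ⟨k, hk⟩ := exists_succSimRel_sim_of_lt h hpi
        exact absurd (hprev _ _ hk).1 (hprev _ _ hii).2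
      · exact h
      · obtain ⟨k, hk⟩ := exists_succSimRel_sim_of_lt h hpi.symm
        exact absurd (hprev _ _ hk).1 (hprev _ _ hp).2
    subst hip
    obtain rfl := (succSim A D 2).out_unique w (.sim 0) _ _ _ hp hii
    exact (hrel _ _ _).1 hz

theorem mem_lang_of_isDoubled (a : A) {w : Word A D 2} (hw : IsDoubled a w) :
    w ∈ (doubledAutomaton a D).lang := by
  obtain ⟨hdv, n, hn, hl, hr⟩ := hw
  have hrk : ∀ k i j, succSimRel w (.sim k) i j ↔ (j : ℕ) = i + n := fun k i j =>
    (succSimRel_sim_iff (fun i => (hdv i).2) k i j).trans (hr i j)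
  -- Testing for position `0` first also covers `n = 1`, where state `1` does not occur.
  let st : Pos w → Fin 3 := fun i => if (i : ℕ) = 0 then 0 else if (i : ℕ) < n then 1 else 2
  let ρ : Pos w → Bool → Option D := fun i r => if r then some (dval w i 0) else
    (prev (succSim A D 2) w SuccSimSym.succ i).map fun j => dval w j 0
  have hsucc : ∀ (i : ℕ) (hi : i + 1 < w.length),
      prev (succSim A D 2) w SuccSimSym.succ ⟨i + 1, hi⟩ = some ⟨i, by omega⟩ :=
    fun i hi => (prev_eq_some_iff _ w _ _ _).2 (by rfl)
  have hsucc0 : ∀ h : 0 < w.length, prev (succSim A D 2) w SuccSimSym.succ ⟨0, h⟩ = none := by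
    intro h
    refine (prev_eq_none_iff _ w _ _).2 ?_
    rintro ⟨j, hj⟩
    exact absurd hj (by simp [succSim, succSimRel])
  have hsim : ∀ (k : Fin 2) (i : ℕ) (hi : i + n < w.length),
      prev (succSim A D 2) w (SuccSimSym.sim k) ⟨i + n, hi⟩ = some ⟨i, by omega⟩ :=
    fun k i hi => (prev_eq_some_iff _ w _ _ _).2 ((hrk k _ _).2 rfl)
  have hsim0 : ∀ (k : Fin 2) (i : Pos w), (i : ℕ) < n →
      prev (succSim A D 2) w (SuccSimSym.sim k) i = none := by
    intro k i hi
    refine (prev_eq_none_iff _ w _ _).2 ?_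
    rintro ⟨j, hj⟩
    have := (hrk k j i).1 hj
    omega
  refine ⟨st, ρ, fun i => ?_, fun i s hs => ?_, ?_⟩
  · suffices h : ∃ t ∈ ({(none, none, 0), (some 0, none, 1), (some 1, none, 1),
        (some 0, some 0, 2), (some 1, some 0, 2), (some 2, some 1, 2)} :
          Set (Option (Fin 3) × Option (Fin 3) × Fin 3)),
        (doubledTransition a D t.1 t.2.1 t.2.2).Fires w st ρ i by
      obtain ⟨t, ht, hf⟩ := h
      exact ⟨_, ⟨t, ht, rfl⟩, hf⟩
    refine ⟨((prev (succSim A D 2) w SuccSimSym.succ i).map st,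
      (prev (succSim A D 2) w (SuccSimSym.sim 0) i).map st, st i), ?_,
      (doubledTransition_fires_iff ..).2 ⟨(hdv i).1.symm, rfl, rfl, fun k => ?_, (hdv i).2, ?_,
        by simp [ρ], ?_⟩⟩
    · obtain ⟨i, hi⟩ := i
      rcases i with _ | i
      · rw [hsucc0, hsim0 _ _ (by simp only; omega)]
        simp [st]
      · rw [hsucc]
        by_cases hin : i + 1 < n
        · rw [hsim0 _ _ (by simpa using hin)]
          by_cases h0 : i = 0 <;> simp [st, h0, hin, show i < n by omega]
          omega
        · obtain ⟨c, hc⟩ : ∃ c, i + 1 = c + n := ⟨i + 1 - n, by omega⟩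
          simp only [hc, hsim]
          by_cases h0 : i = 0 <;> by_cases h1 : c = 0 <;> by_cases h2 : i < n <;>
            by_cases h3 : c < n <;> simp [st, h0, h1, h2, h3] <;> omega
    · by_cases hin : (i : ℕ) < n
      · rw [hsim0 _ _ hin, hsim0 _ _ hin]
      · obtain ⟨c, hc⟩ : ∃ c, (i : ℕ) = c + n := ⟨i - n, by omega⟩
        obtain ⟨i, hi⟩ := i
        simp only at hc
        subst hc
        rw [hsim, hsim]
    · intro h1 h2
      obtain ⟨z, hz, hz2⟩ := Option.map_eq_some_iff.1 h1
      have hzi : (i : ℕ) = z + 1 := (prev_eq_some_iff (succSim A D 2) w SuccSimSym.succ _ _).1 hz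
      have hzn : n ≤ z := by
        by_contra hlt
        by_cases h0 : (z : ℕ) = 0 <;> simp [st, h0, not_le.1 hlt] at hz2
      obtain ⟨b, hb⟩ : ∃ b, (i : ℕ) = b + 1 + n := ⟨z - n, by omega⟩
      obtain ⟨i, hi⟩ := i
      simp only at hb hzi
      subst hb
      -- The class predecessor `b + 1` of the current position stores the value of `b`, and the
      -- direct predecessor `z = b + n` is the class successor of `b`.
      have hbz := ((hr ⟨b, by omega⟩ z).2 (by simp only; omega)).2.1
      refine ⟨dval w z 0, ?_, by simp [hz, ρ]⟩
      rw [hsim, Option.bind_some]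
      simp only [ρ, Bool.false_eq_true, if_false]
      rw [hsucc, Option.map_some, hbz]
    · simp only [ρ]
      cases prev (succSim A D 2) w SuccSimSym.succ i <;> simp
  · cases s with
    | succ => trivial
    | sim k =>
      change st i = 2
      have hin : ¬ (i : ℕ) < n := fun h => hs ⟨⟨i + n, by omega⟩, (hrk k _ _).2 rfl⟩
      simp [st, hin]
      omega
  · change ¬ {i : Pos w | st i = 0}.ncard ≤ 0
    rw [not_le, Set.ncard_pos]
    exact ⟨⟨0, by omega⟩, by simp [st]⟩

theorem setOf_isDoubled_mem_CRAminus (a : A) :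
    {w : Word A D 2 | IsDoubled a w} ∈ CRAminus (succSim A D 2) :=
  ⟨doubledAutomaton a D, nonGuessing_doubledAutomaton a,
    Set.ext fun _ => ⟨isDoubled_of_mem_lang a, mem_lang_of_isDoubled a⟩⟩

end Automaton

end DataWords

theorem mainTheorem9 {A : Type*} [Finite A] {D : Type*} (a : A) (e : ℕ ↪ D) :
    DataWords.equivClosure (DataWords.succSim A D 2) (DataWords.doubledWords a e) ∈
        DataWords.rEMSO (DataWords.succSim A D 2) ∩
          DataWords.CRAminus (DataWords.succSim A D 2) ∧
      DataWords.equivClosure (DataWords.succSim A D 2) (DataWords.doubledWords a e) ∉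
        DataWords.ClassAut A D 2 := by
  have h : DataWords.equivClosure (DataWords.succSim A D 2) (DataWords.doubledWords a e) =
      {w | DataWords.IsDoubled a w} :=
    Set.ext fun w => DataWords.mem_equivClosure_doubledWords_iff a e w
  rw [h]
  exact ⟨⟨DataWords.setOf_isDoubled_mem_rEMSO a, DataWords.setOf_isDoubled_mem_CRAminus a⟩,
    DataWords.setOf_isDoubled_notMem_classAut a e⟩
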